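/- **Setting.** Let $n$ denote the security parameter; $f:\mathbb N\to\mathbb R$ is negligible if $n^d f(n)\to 0$ for every $d$. A (fixed-length) *symmetric-key quantum encryption scheme* $\Pi=(\mathsf{KeyGen},\mathsf{Enc},\mathsf{Dec})$ draws a uniformly random classical key $k$ from a nonempty finite set $\mathcal K_n$ of bit strings and has, for each key, channels $\mathsf{Enc}_k$ from the plaintext register $M$ to the ciphertext register $C$ and $\mathsf{Dec}_k$ from $C$ to $M\oplus\mathbb C|\bot\rangle$, where keys, $M$ and $C$ have polynomially many (qu)bits, such that $\|\mathsf{Dec}_k\circ\mathsf{Enc}_k-(\mathbb 1_M\oplus 0_\bot)\|_\diamond\le\varepsilon(n)$ for all $k\in\mathcal K_n$ and some negligible $\varepsilon$. (The result holds whether or not the three algorithms are efficient.) Decryption is always followed by the measurement $\{|\bot\rangle\langle\bot|,\mathbb 1-|\bot\rangle\langle\bot|\}$. Fix a representation of encryption by classical randomness: for each key, a register $T$ of qubits, a unitary $V_k:M\otimes T\to C$, an orthonormal basis $(|\psi^{(k,r)}\rangle)_r$ of $T$ and a probability distribution $p_k$ with $\mathsf{Enc}_k(X)=V_k\bigl(X\otimes\sum_r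 p_k(r)\Pi_{k,r}\bigr)V_k^\dagger$, $\Pi_{k,r}=|\psi^{(k,r)}\rangle\langle\psi^{(k,r)}|$. "Encrypting with randomness $r$" is the map $X\mapsto V_k(X\otimes\Pi_{k,r})V_k^\dagger$; fresh randomness is drawn from $p_k$. Let $\Pi^+$ be the projector onto the maximally entangled state $|\phi^+\rangle$ of two copies of $M$. In a two-outcome measurement $\{P,\mathbb 1-P\}$ the outcome belonging to $P$ is called $0$. A *QPT adversary* is a family of oracle quantum circuits (over Hadamard, $T$ and CNOT gates, with all qubits initially zero) whose $n$-th member is written down by a Turing machine on input $1^n$ in time polynomial in $n$. **Experiments.** In each of them $k$ is drawn by $\mathsf{KeyGen}(1^n)$. * $\mathsf{QUF\text{-}Forge}(\Pi,\mathcal A,n)$: $\mathcal A$ gets the oracle $\mathsf{Enc}_k$ and outputs a register $C$; the result is $\mathsf{win}$ if $\mathsf{Dec}_k$ of it is not $\bot$, and $\mathsf{reject}$ otherwise. * *Test of a register $C$ against a list of entries $(r,M'')$*: apply $V_k^\dagger$ to $C$, obtaining registers $M'T$. For each entry in turn, measure $\{\Pi_{k,r},\mathbb 1-\Pi_{k,r}\}$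 on $T$; if the outcome is $0$, measure $\{\Pi^+,\mathbb 1-\Pi^+\}$ on $M'M''$; if this outcome is $0$ too, stop: the test *passes at this entry*. If no entry passes, the test *fails*. * $\mathsf{QUF\text{-}Cheat}(\Pi,\mathcal A,n)$: $\mathcal A$ gets an oracle which on input $M$ discards $M$, prepares $|\phi^+\rangle_{M'M''}$, encrypts $M'$ with fresh randomness $r$, returns the ciphertext and stores $(r,M'')$. The final output register $C$ of $\mathcal A$ is tested against the stored entries; the result is $\mathsf{cheat}$ if the test passes and $\mathsf{reject}$ otherwise. * $\mathsf{QAE\text{-}Real}(\Pi,\mathcal A,n)$: $\mathcal A$ gets the oracles $\mathsf{Enc}_k$ and $\mathsf{Dec}_k$ and outputs one of $\mathsf{real}$, $\mathsf{ideal}$. * $\mathsf{QAE\text{-}Ideal}(\Pi,\mathcal A,n)$: $\mathcal A$ gets oracles $E$, $D$ and outputs one of $\mathsf{real}$, $\mathsf{ideal}$. On input $M$, $E$ acts as the oracle of $\mathsf{QUF\text{-}Cheat}$, but stores $(r,M'',M)$, keeping $M$ instead of discarding it. On input $C$, $D$ tests $C$ against the stored entries and returns the register $M$ of the entry at which the test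 passes (the entry is kept, with zeros in place of $M$), or $\bot$ if the test fails. $\Pi$ is $\mathsf{QAE}$ if $\bigl|\Pr[\mathsf{QAE\text{-}Real}(\Pi,\mathcal A,n)\to\mathsf{real}]-\Pr[\mathsf{QAE\text{-}Ideal}(\Pi,\mathcal A,n)\to\mathsf{real}]\bigr|$ is negligible for every QPT adversary $\mathcal A$ with two oracles, and $\mathsf{QUF}$ if $\bigl|\Pr[\mathsf{QUF\text{-}Forge}(\Pi,\mathcal A,n)\to\mathsf{win}]-\Pr[\mathsf{QUF\text{-}Cheat}(\Pi,\mathcal A,n)\to\mathsf{cheat}]\bigr|$ is negligible for every QPT adversary $\mathcal A$ with an encryption oracle only. **Theorem.** Let $\Pi$ be a symmetric-key quantum encryption scheme with a representation as above. 1. If $\Pi$ is $\mathsf{QAE}$, then $\Pi$ is $\mathsf{QUF}$. 2. For every QPT adversary $\mathcal A$ with an encryption oracle only, and $\nu:\mathbb N\to\mathbb R$ with $\Pr[\mathsf{QUF\text{-}Forge}(\Pi,\mathcal A,n)\to\mathsf{win}]=\Pr[\mathsf{QUF\text{-}Cheat}(\Pi,\mathcal A,n)\to\mathsf{cheat}]+\nu(n)$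 for all $n$, there is a QPT adversary $\mathcal B$ with two oracles such that for all $n$ $$\tfrac12\Pr[\mathsf{QAE\text{-}Real}(\Pi,\mathcal B,n)\to\mathsf{real}]-\tfrac12\Pr[\mathsf{QAE\text{-}Ideal}(\Pi,\mathcal B,n)\to\mathsf{real}]=\tfrac{\nu(n)}2,$$ i.e. $\mathcal B$ guesses which of the two equally likely worlds it is in with advantage $\nu(n)/2$ over $1/2$. -/

import Mathlib

open scoped Matrix Kronecker ENNReal ComplexOrder

noncomputable section

namespace QCrypt

/-! ## Registers, operators, channels -/

/-- Labels of the computational basis of a register of `n` qubits. -/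
abbrev Bits (n : ℕ) : Type := Fin n → Bool

/-- The all-zero basis label. -/
def zeros {n : ℕ} : Bits n := fun _ => false

/-- Linear operators on the finite-dimensional Hilbert space with orthonormal basis `A`. -/
abbrev Op (A : Type) : Type := Matrix A A ℂ

/-- `ρ ↦ K ρ K†`. -/
def conj {A B : Type} [Fintype A] (K : Matrix B A ℂ) (ρ : Op A) : Op B := K * ρ * Kᴴ

/-- `K ⊗ 1` applied to a state of a composite system: `ρ ↦ (K ⊗ 1) ρ (K ⊗ 1)†`. -/
def conjLeft {A B S : Type} [Fintype A] [Fintype S] [DecidableEq S]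
    (K : Matrix B A ℂ) (ρ : Op (A × S)) : Op (B × S) :=
  conj (K ⊗ₖ (1 : Matrix S S ℂ)) ρ

/-- `Φ ⊗ id` for a map `Φ` on operators. -/
def ampliate {A B S : Type} (Φ : Op A → Op B) (X : Op (A × S)) : Op (B × S) :=
  Matrix.of fun p q => Φ (Matrix.of fun a a' => X (a, p.2) (a', q.2)) p.1 q.1

/-- Quantum channels: completely positive, trace-preserving maps. -/
structure IsChannel {A B : Type} [Fintype A] [Fintype B] (Φ : Op A →ₗ[ℂ] Op B) : Prop where
  completelyPositive : ∀ (d : ℕ) (X : Op (A × Fin d)), X.PosSemidef → (ampliate Φ X).PosSemidef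
  tracePreserving : ∀ X : Op A, (Φ X).trace = X.trace

/-- The trace norm: the sum of the singular values. -/
def traceNorm {A : Type} [Fintype A] [DecidableEq A] (X : Op A) : ℝ :=
  ∑ i, Real.sqrt ((Matrix.isHermitian_conjTranspose_mul_self X).eigenvalues i)

/-- The diamond norm: the supremum, over all ancilla dimensions, of the trace norm of
`(Φ ⊗ id) X` for `X` of trace norm at most one. -/
def diamondNorm {A B : Type} [Fintype A] [DecidableEq A] [Fintype B] [DecidableEq B]
    (Φ : Op A →ₗ[ℂ] Op B) : ℝ≥0∞ :=
  ⨆ (d : ℕ) (X : Op (A × Fin d)) (_ : traceNorm X ≤ 1), ENNReal.ofReal (traceNorm (ampliate Φ X))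

/-- `1_M ⊕ 0_⊥`: operators on `M`, regarded as operators on `M ⊕ ⊥`. The basis of `M ⊕ ⊥` is
`Option M`, with `none` labelling `⊥`. -/
def withBot (M : Type) : Op M →ₗ[ℂ] Op (Option M) where
  toFun X := Matrix.of fun a b =>
    match a, b with
    | some x, some y => X x y
    | _, _ => 0
  map_add' X Y := by ext (_ | a) (_ | b) <;> simp
  map_smul' z X := by ext (_ | a) (_ | b) <;> simp

/-- The projector onto the maximally entangled state `|φ⁺⟩ = 2^{-m/2} ∑ₓ |x⟩|x⟩`. -/
def phiPlus (m : ℕ) : Op (Bits m × Bits m) :=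
  Matrix.of fun p q => if p.1 = p.2 ∧ q.1 = q.2 then 1 / 2 ^ m else 0

/-! ## Asymptotics -/

/-- Negligible functions of the security parameter. -/
def Negligible (f : ℕ → ℝ) : Prop :=
  Asymptotics.SuperpolynomialDecay Filter.atTop (fun n : ℕ => (n : ℝ)) f

/-- Polynomially bounded lengths. -/
def PolyBounded (f : ℕ → ℕ) : Prop := ∃ p : Polynomial ℕ, ∀ n, f n ≤ p.eval n

/-! ## Symmetric-key quantum encryption -/

/-- A symmetric-key quantum encryption scheme of fixed length: for each security parameter `n`, a
key drawn uniformly from a set of classical keys, encryption channels from `M` to `C` and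
decryption channels from `C` to `M ⊕ ⊥`, correct up to a negligible diamond-norm error. All
registers have polynomially many qubits. (No bound on the running time of the three algorithms
is imposed: every statement about these objects covers in particular the efficient ones.) -/
structure SKQES where
  keyLen : ℕ → ℕ
  msgLen : ℕ → ℕ
  ctxLen : ℕ → ℕ
  keyLen_poly : PolyBounded keyLen
  msgLen_poly : PolyBounded msgLen
  ctxLen_poly : PolyBounded ctxLen
  keys : ∀ n, Finset (Bits (keyLen n))
  keys_nonempty : ∀ n, (keys n).Nonempty
  enc : ∀ n, Bits (keyLen n) → (Op (Bits (msgLen n)) →ₗ[ℂ] Op (Bits (ctxLen n)))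
  dec : ∀ n, Bits (keyLen n) → (Op (Bits (ctxLen n)) →ₗ[ℂ] Op (Option (Bits (msgLen n))))
  enc_channel : ∀ n, ∀ k ∈ keys n, IsChannel (enc n k)
  dec_channel : ∀ n, ∀ k ∈ keys n, IsChannel (dec n k)
  correct : ∃ ε : ℕ → ℝ, Negligible ε ∧ ∀ n, ∀ k ∈ keys n,
    diamondNorm (dec n k ∘ₗ enc n k - withBot (Bits (msgLen n))) ≤ ENNReal.ofReal (ε n)

/-- The data `V`, `p`, `ψ` by which encryption under a fixed key is carried out with explicit
classical randomness `r`: draw `r` from `p`, attach `|ψ r⟩` in a tag register `T` of `t` qubits,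
apply `V`. -/
structure EncData (m c t : ℕ) where
  V : Matrix (Bits c) (Bits m × Bits t) ℂ
  p : Bits t → ℝ
  ψ : Bits t → Bits t → ℂ

/-- The projector `|ψ r⟩⟨ψ r|` on the tag register. -/
def EncData.tagProj {m c t : ℕ} (d : EncData m c t) (r : Bits t) : Op (Bits t) :=
  Matrix.vecMulVec (d.ψ r) (star (d.ψ r))

/-- Encryption with fixed randomness: `X ↦ V (X ⊗ |ψ r⟩⟨ψ r|) V†`. -/
def EncData.encWith {m c t : ℕ} (d : EncData m c t) (r : Bits t) (X : Op (Bits m)) :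
    Op (Bits c) :=
  conj d.V (X ⊗ₖ d.tagProj r)

/-- `d` describes the map `E`: `V` is unitary, `p` is a probability distribution, the `ψ r` form
an orthonormal basis of `T`, and `E X = V (X ⊗ σ) V†` with `σ = ∑ᵣ p r |ψ r⟩⟨ψ r|`. -/
structure EncData.Describes {m c t : ℕ} (d : EncData m c t)
    (E : Op (Bits m) →ₗ[ℂ] Op (Bits c)) : Prop where
  isometry : d.Vᴴ * d.V = 1
  coisometry : d.V * d.Vᴴ = 1
  p_nonneg : ∀ r, 0 ≤ d.p r
  p_sum : ∑ r, d.p r = 1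
  orthonormal : ∀ r r', star (d.ψ r) ⬝ᵥ d.ψ r' = if r = r' then 1 else 0
  enc_eq : ∀ X, E X = conj d.V (X ⊗ₖ ∑ r, (d.p r : ℂ) • d.tagProj r)

/-- A choice, for every security parameter and key, of the data `V_k`, `p_k`, `ψ_{k,r}` describing
the encryption maps of a scheme. The challengers of the cheat-detecting games use this choice. -/
structure SKQES.Representation (S : SKQES) where
  tagLen : ℕ → ℕ
  data : ∀ n, Bits (S.keyLen n) → EncData (S.msgLen n) (S.ctxLen n) (tagLen n)
  describes : ∀ n, ∀ k ∈ S.keys n, (data n k).Describes (S.enc n k)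

/-! ## Oracle circuits

The adversary holds a flag qubit, a plaintext register `M`, a ciphertext register `C` and a work
register. Oracle calls act on the registers `M`, `C` and the flag:
* an encryption call hands over `M` and receives a ciphertext in `C`;
* a decryption call hands over `C` and receives the answer in the flag and `M`, the flag being `1`
  if the answer is a plaintext and `0` if it is `⊥`.

Registers handed over are refilled with zeros, the previous contents of registers in which an
answer is received are discarded. All qubits are zero at the beginning. -/

inductive Wire (m c w : ℕ) : Type where
  | flag : Wire m c w
  | msg : Fin m → Wire m c w
  | ctx : Fin c → Wire m c w
  | work : Fin w → Wire m c w

inductive Gate (m c w : ℕ) : Type where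
  | hadamard : Wire m c w → Gate m c w
  | tgate : Wire m c w → Gate m c w
  | cnot (control target : Wire m c w) : control ≠ target → Gate m c w
  | enc : Gate m c w
  | dec : Gate m c w

/-- A finite alphabet for writing down circuits. -/
inductive Sym : Type where
  | hadamard | tgate | cnot | enc | dec | flag | msg | ctx | work | tick
  deriving DecidableEq

/-- A wire is written as the name of its register and its position in unary. -/
def Wire.code {m c w : ℕ} : Wire m c w → List Sym
  | .flag => [.flag]
  | .msg i => .msg :: List.replicate i .tick
  | .ctx i => .ctx :: List.replicate i .tick
  | .work i => .work :: List.replicate i .tick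

def Gate.code {m c w : ℕ} : Gate m c w → List Sym
  | .hadamard i => .hadamard :: i.code
  | .tgate i => .tgate :: i.code
  | .cnot i j _ => .cnot :: (i.code ++ j.code)
  | .enc => [.enc]
  | .dec => [.dec]

/-- The content of the output stack of a machine that writes a circuit gate by gate, in order of
execution: the symbol written last is on top, i.e. is the head of the list. -/
def circuitCode {m c w : ℕ} (gs : List (Gate m c w)) : List Sym :=
  (gs.flatMap Gate.code).reverse

/-- Quantum polynomial-time oracle algorithms: families of oracle circuits over the gate set
Hadamard, T, CNOT, such that a Turing machine writes down the `n`-th circuit on input `1ⁿ` in time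
polynomial in `n`. -/
structure Adversary (S : SKQES) where
  workLen : ℕ → ℕ
  workLen_poly : PolyBounded workLen
  circuit : ∀ n, List (Gate (S.msgLen n) (S.ctxLen n) (workLen n))
  uniform : Nonempty (Turing.TM2ComputableInPolyTime Computability.unaryEncodeNat
    (id : List Sym → List Sym) (fun n => circuitCode (circuit n)))

/-- The adversary uses no decryption oracle. -/
def Adversary.EncOnly {S : SKQES} (A : Adversary S) : Prop :=
  ∀ n, Gate.dec ∉ A.circuit n

/-- Basis of the adversary's space: flag, `M`, `C`, work register. -/
abbrev Adv (m c w : ℕ) : Type := Bool × Bits m × Bits c × Bits w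

def Adv.get {m c w : ℕ} (s : Adv m c w) : Wire m c w → Bool
  | .flag => s.1
  | .msg i => s.2.1 i
  | .ctx i => s.2.2.1 i
  | .work i => s.2.2.2 i

def Adv.init {m c w : ℕ} : Adv m c w := (false, zeros, zeros, zeros)

def hadamardMatrix : Op Bool :=
  Matrix.of fun a b => (if a && b then -1 else 1) / (Real.sqrt 2 : ℂ)

def tMatrix : Op Bool :=
  Matrix.diagonal fun a => if a then Complex.exp (Complex.I * Real.pi / 4) else 1

open Classical in
/-- The one-qubit operator `g` applied to the wire `i`. -/
def onWire {m c w : ℕ} (g : Op Bool) (i : Wire m c w) : Op (Adv m c w) :=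
  Matrix.of fun s s' =>
    if ∀ l, l ≠ i → Adv.get s l = Adv.get s' l then g (Adv.get s i) (Adv.get s' i) else 0

open Classical in
/-- The permutation operator of CNOT with control `i` and target `j`. -/
def cnotMatrix {m c w : ℕ} (i j : Wire m c w) : Op (Adv m c w) :=
  Matrix.of fun s s' =>
    if (∀ l, l ≠ j → Adv.get s l = Adv.get s' l) ∧
        Adv.get s j = xor (Adv.get s' j) (Adv.get s' i) then 1 else 0

/-! ## The real oracles -/

section Real

variable {m c w : ℕ}

def realEnc (E : Op (Bits m) →ₗ[ℂ] Op (Bits c)) (ρ : Op (Adv m c w)) : Op (Adv m c w) :=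
  Matrix.of fun (f, x, y, z) (f', x', y', z') =>
    if x = zeros ∧ x' = zeros then
      E (Matrix.of fun u u' => ∑ v, ρ (f, u, v, z) (f', u', v, z')) y y'
    else 0

/-- Decryption, followed by the measurement of whether the result is `⊥`. -/
def realDec (D : Op (Bits c) →ₗ[ℂ] Op (Option (Bits m))) (ρ : Op (Adv m c w)) :
    Op (Adv m c w) :=
  Matrix.of fun (f, x, y, z) (f', x', y', z') =>
    let σ := D (Matrix.of fun v v' => ∑ g, ∑ u, ρ (g, u, v, z) (g, u, v', z'))
    if y = zeros ∧ y' = zeros then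
      match f, f' with
      | true, true => σ (some x) (some x')
      | false, false => if x = zeros ∧ x' = zeros then σ none none else 0
      | _, _ => 0
    else 0

def realRun (E : Op (Bits m) →ₗ[ℂ] Op (Bits c)) (D : Op (Bits c) →ₗ[ℂ] Op (Option (Bits m))) :
    List (Gate m c w) → Op (Adv m c w) → Op (Adv m c w)
  | [], ρ => ρ
  | .hadamard i :: gs, ρ => realRun E D gs (conj (onWire hadamardMatrix i) ρ)
  | .tgate i :: gs, ρ => realRun E D gs (conj (onWire tMatrix i) ρ)
  | .cnot i j _ :: gs, ρ => realRun E D gs (conj (cnotMatrix i j) ρ)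
  | .enc :: gs, ρ => realRun E D gs (realEnc E ρ)
  | .dec :: gs, ρ => realRun E D gs (realDec D ρ)

/-- The reduced state of the register `C`. -/
def ctxState (ρ : Op (Adv m c w)) : Op (Bits c) :=
  Matrix.of fun y y' => ∑ f, ∑ x, ∑ z, ρ (f, x, y, z) (f, x, y', z)

end Real

/-! ## The cheat-detecting challenger

After `q` encryption calls, in which the randomness `r 0, …, r (q - 1)` was used, the challenger
holds the reference halves `M''` of `q` maximally entangled pairs, a register with basis
`Fin q → Bits m`, and possibly further registers, with basis `E`. -/

section Ideal

variable {m c t w q : ℕ}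

/-- `Enc` with randomness `r`, applied to the first half of a maximally entangled pair. -/
def encHalf (d : EncData m c t) (r : Bits t) : Op (Bits c × Bits m) :=
  ampliate (d.encWith r) (phiPlus m)

/-- Basis of the registers tested by the challenger: the decoded registers `M` and `T`, and all
the reference halves. -/
abbrev Tested (m t q : ℕ) : Type := (Bits m × Bits t) × (Fin q → Bits m)

/-- `Π_{k,r}` on `T`. -/
def tagTest (d : EncData m c t) (r : Bits t) : Op (Tested m t q) :=
  Matrix.of fun ((x, s), a) ((x', s'), a') => if x = x' ∧ a = a' then d.tagProj r s s' else 0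

/-- `Π⁺` on `M` and the `i`-th reference half. -/
def entTest (i : Fin q) : Op (Tested m t q) :=
  Matrix.of fun ((x, s), a) ((x', s'), a') =>
    if s = s' ∧ ∀ j, j ≠ i → a j = a' j then phiPlus m (x, a i) (x', a' i) else 0

/-- `V†` is applied to the register `C`, giving `M` and `T`; the remaining registers are only
rearranged. -/
def undoV {E : Type} (d : EncData m c t)
    (ρ : Op (Adv m c w × (Fin q → Bits m) × E)) :
    Op (Tested m t q × (Bool × Bits m × Bits w) × E) :=
  Matrix.of fun ((u, a), (f, x, z), e) ((u', a'), (f', x', z'), e') =>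
    conj d.Vᴴ (Matrix.of fun y y' => ρ ((f, x, y, z), a, e) ((f', x', y', z'), a', e')) u u'

/-- The sequence of tests on a list of entries of the challenger's memory. On the entry `i`, the
measurement `{Π_{k,r i}, 1 - Π_{k,r i}}` is applied to `T`; if its outcome is `0`, the measurement
`{Π⁺, 1 - Π⁺}` is applied to `M` and the `i`-th reference half; if its outcome is `0` too, the
procedure ends with the result `accept i`. In all other cases it goes on with the next entry, and
ends with the result `reject` after the last one. States are not normalized: the results of all
branches add up. -/
def testLoop {R β : Type} [Add β] [Fintype R] [DecidableEq R] (d : EncData m c t)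
    (r : Fin q → Bits t) (accept : Fin q → Op (Tested m t q × R) → β)
    (reject : Op (Tested m t q × R) → β) :
    List (Fin q) → Op (Tested m t q × R) → β
  | [], σ => reject σ
  | i :: is, σ =>
    accept i (conjLeft (entTest i * tagTest d (r i)) σ) +
      testLoop d r accept reject is
        (conjLeft (1 - tagTest d (r i)) σ + conjLeft ((1 - entTest i) * tagTest d (r i)) σ)

/-! ### The game with a final test -/

/-- An encryption call: `M` is discarded, half of a maximally entangled pair is encrypted with
randomness `r`, the other half is stored. -/
def cheatEnc (d : EncData m c t) (r : Bits t) (ρ : Op (Adv m c w × (Fin q → Bits m) × Unit)) :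
    Op (Adv m c w × (Fin (q + 1) → Bits m) × Unit) :=
  Matrix.of fun ((f, x, y, z), a, _) ((f', x', y', z'), a', _) =>
    if x = zeros ∧ x' = zeros then
      (∑ u, ∑ v, ρ ((f, u, v, z), Fin.init a, ()) ((f', u, v, z'), Fin.init a', ())) *
        encHalf d r (y, a (Fin.last q)) (y', a' (Fin.last q))
    else 0

/-- Probability of the outcome `cheat`, after the remaining gates are executed and the final
content of `C` is tested. Adversaries in this game have no decryption oracle; the corresponding
gate is skipped. -/
def cheatRun (d : EncData m c t) : List (Gate m c w) → (q : ℕ) → (Fin q → Bits t) →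
    Op (Adv m c w × (Fin q → Bits m) × Unit) → ℝ
  | [], q, r, ρ =>
    testLoop d r (fun _ σ => σ.trace.re) (fun _ => 0) (List.finRange q) (undoV d ρ)
  | .hadamard i :: gs, q, r, ρ => cheatRun d gs q r (conjLeft (onWire hadamardMatrix i) ρ)
  | .tgate i :: gs, q, r, ρ => cheatRun d gs q r (conjLeft (onWire tMatrix i) ρ)
  | .cnot i j _ :: gs, q, r, ρ => cheatRun d gs q r (conjLeft (cnotMatrix i j) ρ)
  | .enc :: gs, q, r, ρ =>
    ∑ r₀, d.p r₀ * cheatRun d gs (q + 1) (Fin.snoc (α := fun _ => Bits t) r r₀) (cheatEnc d r₀ ρ)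
  | .dec :: gs, q, r, ρ => cheatRun d gs q r ρ

/-! ### The ideal world: the plaintexts are stored as well (`E = Fin q → Bits m`) -/

/-- An encryption call: `M` is stored, half of a maximally entangled pair is encrypted with
randomness `r`, the other half is stored. -/
def idealEnc (d : EncData m c t) (r : Bits t)
    (ρ : Op (Adv m c w × (Fin q → Bits m) × (Fin q → Bits m))) :
    Op (Adv m c w × (Fin (q + 1) → Bits m) × (Fin (q + 1) → Bits m)) :=
  Matrix.of fun ((f, x, y, z), a, b) ((f', x', y', z'), a', b') =>
    if x = zeros ∧ x' = zeros then
      (∑ v, ρ ((f, b (Fin.last q), v, z), Fin.init a, Fin.init b)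
        ((f', b' (Fin.last q), v, z'), Fin.init a', Fin.init b')) *
        encHalf d r (y, a (Fin.last q)) (y', a' (Fin.last q))
    else 0

/-- The answer to a decryption call that passed the test on the entry `i`: the `i`-th stored
plaintext is moved to the adversary's register `M` (zeros are left in its place), and the flag is
set; the decoded registers are discarded. -/
def idealAccept (i : Fin q)
    (σ : Op (Tested m t q × (Bool × Bits m × Bits w) × (Fin q → Bits m))) :
    Op (Adv m c w × (Fin q → Bits m) × (Fin q → Bits m)) :=
  Matrix.of fun ((f, x, y, z), a, b) ((f', x', y', z'), a', b') =>
    if (f = true ∧ f' = true) ∧ (y = zeros ∧ y' = zeros) ∧ (b i = zeros ∧ b' i = zeros) then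
      ∑ u, ∑ g, ∑ v, σ ((u, a), (g, v, z), Function.update b i x)
        ((u, a'), (g, v, z'), Function.update b' i x')
    else 0

/-- The answer `⊥` to a decryption call. -/
def idealReject (σ : Op (Tested m t q × (Bool × Bits m × Bits w) × (Fin q → Bits m))) :
    Op (Adv m c w × (Fin q → Bits m) × (Fin q → Bits m)) :=
  Matrix.of fun ((f, x, y, z), a, b) ((f', x', y', z'), a', b') =>
    if (f = false ∧ f' = false) ∧ (x = zeros ∧ x' = zeros) ∧ (y = zeros ∧ y' = zeros) then
      ∑ u, ∑ g, ∑ v, σ ((u, a), (g, v, z), b) ((u, a'), (g, v, z'), b')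
    else 0

def idealDec (d : EncData m c t) (r : Fin q → Bits t)
    (ρ : Op (Adv m c w × (Fin q → Bits m) × (Fin q → Bits m))) :
    Op (Adv m c w × (Fin q → Bits m) × (Fin q → Bits m)) :=
  testLoop d r idealAccept idealReject (List.finRange q) (undoV d ρ)

/-- Probability that the flag is measured to be `1` after the remaining gates are executed. -/
def idealRun (d : EncData m c t) : List (Gate m c w) → (q : ℕ) → (Fin q → Bits t) →
    Op (Adv m c w × (Fin q → Bits m) × (Fin q → Bits m)) → ℝ
  | [], _, _, ρ => ∑ s, if s.1.1 = true then (ρ s s).re else 0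
  | .hadamard i :: gs, q, r, ρ => idealRun d gs q r (conjLeft (onWire hadamardMatrix i) ρ)
  | .tgate i :: gs, q, r, ρ => idealRun d gs q r (conjLeft (onWire tMatrix i) ρ)
  | .cnot i j _ :: gs, q, r, ρ => idealRun d gs q r (conjLeft (cnotMatrix i j) ρ)
  | .enc :: gs, q, r, ρ =>
    ∑ r₀, d.p r₀ * idealRun d gs (q + 1) (Fin.snoc (α := fun _ => Bits t) r r₀) (idealEnc d r₀ ρ)
  | .dec :: gs, q, r, ρ => idealRun d gs q r (idealDec d r ρ)

end Ideal

/-! ## The experiments -/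

namespace SKQES

variable (S : SKQES)

/-- Average over a uniformly random key. -/
def keyAverage (n : ℕ) (f : Bits (S.keyLen n) → ℝ) : ℝ :=
  (∑ k ∈ S.keys n, f k) / (S.keys n).card

open Classical in
/-- The basis state `|s⟩⟨s|`. -/
def pureBasis {A : Type} (s : A) : Op A := Matrix.of fun a b => if a = s ∧ b = s then 1 else 0

/-- `Pr[QUF-Forge → win]`: the adversary outputs its register `C`, which decrypts to a
plaintext. -/
def probForge (A : Adversary S) (n : ℕ) : ℝ :=
  S.keyAverage n fun k =>
    ∑ x, (S.dec n k (ctxState (realRun (S.enc n k) (S.dec n k) (A.circuit n)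
      (pureBasis Adv.init))) (some x) (some x)).re

/-- `Pr[QUF-Cheat → cheat]`. -/
def probCheat (R : S.Representation) (A : Adversary S) (n : ℕ) : ℝ :=
  S.keyAverage n fun k =>
    cheatRun (R.data n k) (A.circuit n) 0 Fin.elim0 (pureBasis (Adv.init, Fin.elim0, ()))

/-- `Pr[QAE-Real → real]`: the adversary outputs its flag qubit, `1` meaning `real`. -/
def probReal (A : Adversary S) (n : ℕ) : ℝ :=
  S.keyAverage n fun k =>
    ∑ s, if s.1 = true then
      (realRun (S.enc n k) (S.dec n k) (A.circuit n) (pureBasis Adv.init) s s).re else 0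

/-- `Pr[QAE-Ideal → real]`. -/
def probIdeal (R : S.Representation) (A : Adversary S) (n : ℕ) : ℝ :=
  S.keyAverage n fun k =>
    idealRun (R.data n k) (A.circuit n) 0 Fin.elim0 (pureBasis (Adv.init, Fin.elim0, Fin.elim0))

/-- Quantum authenticated encryption. -/
def IsQAE (R : S.Representation) : Prop :=
  ∀ A : Adversary S, Negligible fun n => |S.probReal A n - S.probIdeal R A n|

/-- Quantum unforgeability. -/
def IsQUF (R : S.Representation) : Prop :=
  ∀ A : Adversary S, A.EncOnly → Negligible fun n => |S.probForge A n - S.probCheat R A n|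

end SKQES

end QCrypt

end

/-! One reduction, `Adversary.thenDec`, proves both claims: run the forger, submit its final
register C to the decryption oracle, and output the resulting flag. In the real world the flag is 1
exactly when decryption does not give ⊥, so the probability of `real` is that of winning the forging
game (`probReal_thenDec`). In the ideal world the flag is 1 exactly when the test on C passes
(`flagProb_testLoop`). The ideal challenger differs from the cheat-detecting one only in keeping the
plaintexts. Before the final call nothing reads them, and every operation of the ideal world
commutes with tracing them out, which leaves the cheating game (`idealRun_append_dec`,
`probIdeal_thenDec`). Both identities are exact for every n, so the distinguishing gap is the
forging gap itself. The new circuit family must again be uniform. Its code has one additional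
symbol, and a Turing machine can push this symbol with a single further step
(`TM2ComputableInPolyTime.cons`). -/

/-! ## Writing one more symbol in polynomial time -/

namespace Turing

namespace TM2.Stmt

/-- The statement obtained by jumping to a new label, called `none`, instead of halting. -/
def haltToNone {K : Type*} {Γ : K → Type*} {Λ σ : Type*} :
    TM2.Stmt Γ Λ σ → TM2.Stmt Γ (Option Λ) σ
  | .push k f s => .push k f s.haltToNone
  | .peek k f s => .peek k f s.haltToNone
  | .pop k f s => .pop k f s.haltToNone
  | .load a s => .load a s.haltToNone
  | .branch p s₁ s₂ => .branch p s₁.haltToNone s₂.haltToNone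
  | .goto l => .goto fun v => some (l v)
  | .halt => .goto fun _ => none

end TM2.Stmt

/-- A configuration, regarded as a configuration of a machine with a new label `none` which takes
the place of the halting state. -/
def TM2.Cfg.haltToNone {K : Type*} {Γ : K → Type*} {Λ σ : Type*} (a : TM2.Cfg Γ Λ σ) :
    TM2.Cfg Γ (Option Λ) σ :=
  ⟨some a.l, a.var, a.stk⟩

/-- Only the leaves of a statement choose the next label, and there halting has become a jump to
`none`; the memory and stack operations are untouched. -/
theorem TM2.stepAux_haltToNone {K : Type*} [DecidableEq K] {Γ : K → Type*} {Λ σ : Type*}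
    (s : TM2.Stmt Γ Λ σ) (v : σ) (T : ∀ k, List (Γ k)) :
    TM2.stepAux s.haltToNone v T = (TM2.stepAux s v T).haltToNone := by
  induction s generalizing v T with
  | branch p s₁ s₂ ih₁ ih₂ =>
    simp only [TM2.Stmt.haltToNone, TM2.stepAux, ih₁, ih₂]
    cases p v <;> rfl
  | goto l => rfl
  | halt => rfl
  | _ => simp_all [TM2.Stmt.haltToNone]

/-- The machine that, when `tm` would halt, first pushes `g` on the output stack. -/
def FinTM2.thenPush (tm : FinTM2) (g : tm.Γ tm.k₁) : FinTM2 where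
  K := tm.K
  kDecidableEq := tm.kDecidableEq
  kFin := tm.kFin
  k₀ := tm.k₀
  k₁ := tm.k₁
  Γ := tm.Γ
  Λ := Option tm.Λ
  main := some tm.main
  ΛFin := @instFintypeOption _ tm.ΛFin
  σ := tm.σ
  initialState := tm.initialState
  σFin := tm.σFin
  Γk₀Fin := tm.Γk₀Fin
  m
    | some l => (tm.m l).haltToNone
    | none => .push tm.k₁ (fun _ => g) .halt

theorem FinTM2.thenPush_step (tm : FinTM2) (g : tm.Γ tm.k₁) (a b : tm.Cfg)
    (h : tm.step a = some b) :
    (tm.thenPush g).step (TM2.Cfg.haltToNone a) = some (TM2.Cfg.haltToNone b) := by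
  obtain ⟨_ | l, v, T⟩ := a
  · exact absurd h (by simp [FinTM2.step, TM2.step])
  · have hb : TM2.stepAux (tm.m l) v T = b := Option.some.inj h
    rw [← hb]
    exact congrArg some (TM2.stepAux_haltToNone (tm.m l) v T)

/-- The simulation is step by step, so a run takes the same number of steps and ends at the new
label instead of halting. -/
theorem FinTM2.thenPush_iterate (tm : FinTM2) (g : tm.Γ tm.k₁) (a b : tm.Cfg) (n : ℕ)
    (h : (flip bind tm.step)^[n] (some a) = some b) :
    (flip bind (tm.thenPush g).step)^[n] (some (TM2.Cfg.haltToNone a : (tm.thenPush g).Cfg)) =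
      some (TM2.Cfg.haltToNone b) := by
  induction n generalizing b with
  | zero => exact congrArg some (congrArg TM2.Cfg.haltToNone (Option.some.inj h))
  | succ n ih =>
    rw [Function.iterate_succ_apply'] at h ⊢
    obtain ⟨e, he, hb⟩ := Option.bind_eq_some_iff.1 h
    rw [ih e he]
    exact tm.thenPush_step g e b hb

theorem haltList_stk_output (tm : FinTM2) (l : List (tm.Γ tm.k₁)) :
    (haltList tm l).stk tm.k₁ = l := by
  simp [haltList]

theorem haltList_stk_of_ne (tm : FinTM2) (l : List (tm.Γ tm.k₁)) {k : tm.K} (hk : k ≠ tm.k₁) :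
    (haltList tm l).stk k = [] := by
  simp [haltList, hk]

/-- A whole statement is executed in one step, so the push and the halt together cost one step; this
is the summand 1 in the time bound of `TM2ComputableInPolyTime.cons`. -/
theorem FinTM2.thenPush_step_haltList (tm : FinTM2) (g : tm.Γ tm.k₁) (l : List (tm.Γ tm.k₁)) :
    (tm.thenPush g).step (TM2.Cfg.haltToNone (haltList tm l)) =
      some (haltList (tm.thenPush g) (g :: l)) := by
  have h : Function.update (haltList tm l).stk tm.k₁ (g :: (haltList tm l).stk tm.k₁) =
      (haltList (tm.thenPush g) (g :: l)).stk := by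
    funext k
    change tm.K at k
    by_cases hk : k = tm.k₁
    · subst hk
      rw [Function.update_self, haltList_stk_output]
      exact (haltList_stk_output (tm.thenPush g) (g :: l)).symm
    · rw [Function.update_of_ne hk, haltList_stk_of_ne tm l hk]
      exact (haltList_stk_of_ne (tm.thenPush g) (g :: l) hk).symm
  exact congrArg some (congrArg (TM2.Cfg.mk none tm.initialState) h)

/-- If `f` is computable in polynomial time, so is the function that puts a fixed symbol in front
of the values of `f`. -/
noncomputable def TM2ComputableInPolyTime.cons {α αΓ βΓ : Type} {ea : α → List αΓ} {f : α → List βΓ}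
    (h : TM2ComputableInPolyTime ea (id : List βΓ → List βΓ) f) (b : βΓ) :
    TM2ComputableInPolyTime ea (id : List βΓ → List βΓ) fun a => b :: f a where
  tm := h.tm.thenPush (h.outputAlphabet.symm b)
  inputAlphabet := h.inputAlphabet
  outputAlphabet := h.outputAlphabet
  time := h.time + 1
  outputsFun a :=
    { steps := (h.outputsFun a).steps + 1
      evals_in_steps := by
        refine (Function.iterate_succ_apply' _ _ _).trans ?_
        refine (congrArg _ (h.tm.thenPush_iterate _ _ _ _ (h.outputsFun a).evals_in_steps)).trans ?_
        exact h.tm.thenPush_step_haltList _ _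
      steps_le_m := by
        rw [Polynomial.eval_add, Polynomial.eval_one]
        exact Nat.add_le_add_right (h.outputsFun a).steps_le_m 1 }

end Turing


noncomputable section

namespace QCrypt

/-! ## The forger followed by a decryption call -/

/-- The adversary that runs `A` and then makes one decryption call, so that the flag tells whether
the ciphertext produced by `A` is accepted. -/
def Adversary.thenDec {S : SKQES} (A : Adversary S) : Adversary S where
  workLen := A.workLen
  workLen_poly := A.workLen_poly
  circuit n := A.circuit n ++ [.dec]
  uniform := by
    obtain ⟨h⟩ := A.uniform
    -- `circuitCode` reverses the written word, so a gate appended at the end of the circuit becomes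
    -- the head of the code.
    have heq : (fun n => circuitCode (A.circuit n ++ [Gate.dec])) =
        fun n => Sym.dec :: circuitCode (A.circuit n) := by
      funext n
      simp [circuitCode, Gate.code]
    rw [heq]
    exact ⟨h.cons Sym.dec⟩

/-! ## The real world -/

section Real

variable {m c w : ℕ}

theorem realRun_append_dec (E : Op (Bits m) →ₗ[ℂ] Op (Bits c))
    (D : Op (Bits c) →ₗ[ℂ] Op (Option (Bits m))) (gs : List (Gate m c w)) (ρ : Op (Adv m c w)) :
    realRun E D (gs ++ [.dec]) ρ = realDec D (realRun E D gs ρ) := by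
  induction gs generalizing ρ with
  | nil => rfl
  | cons g gs ih => cases g <;> exact ih _

/-- `realDec` feeds the decryption map one block for each basis state of the work register;
linearity then gives its value on the whole reduced state. -/
theorem ctxState_eq_sum (ρ : Op (Adv m c w)) :
    ctxState ρ =
      ∑ z, (Matrix.of fun v v' => ∑ g, ∑ u, ρ (g, u, v, z) (g, u, v', z) : Op (Bits c)) := by
  ext y y'
  simp only [ctxState, Matrix.of_apply, Matrix.sum_apply]
  symm
  rw [Finset.sum_comm]
  exact Finset.sum_congr rfl fun _ _ => Finset.sum_comm

/-- After a decryption call, the flag is `1` with the probability that `C` is not decrypted to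
`⊥`. -/
theorem sum_flag_realDec (D : Op (Bits c) →ₗ[ℂ] Op (Option (Bits m))) (ρ : Op (Adv m c w)) :
    (∑ s, if s.1 = true then (realDec D ρ s s).re else 0) =
      ∑ x, (D (ctxState ρ) (some x) (some x)).re := by
  have hre : ∀ (y : Bits c) (z : ℂ), (if y = zeros then z else 0).re =
      if y = zeros then z.re else 0 := fun y z => by split_ifs <;> rfl
  simp only [Fintype.sum_prod_type, Fintype.sum_bool, realDec, Matrix.of_apply, if_true,
    and_self, Bool.false_eq_true, if_false, Finset.sum_const_zero, add_zero, hre]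
  rw [ctxState_eq_sum, map_sum]
  refine Finset.sum_congr rfl fun x _ => ?_
  -- The register C is refilled with zeros after the call, so only this basis state contributes.
  rw [Finset.sum_eq_single (zeros : Bits c) (fun y _ hy => by simp [hy]) (by simp)]
  simp [Matrix.sum_apply]

end Real

/-! ## The ideal world -/

section Ideal

/-! ### Tracing out the stored plaintexts -/

/-- The partial trace over the last register. -/
def traceLast {A S E : Type} [Fintype E] (ρ : Op (A × S × E)) : Op (A × S × Unit) :=
  Matrix.of fun p q => ∑ e, ρ (p.1, p.2.1, e) (q.1, q.2.1, e)

theorem conjLeft_apply {A B S : Type} [Fintype A] [Fintype S] [DecidableEq S]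
    (K : Matrix B A ℂ) (ρ : Op (A × S)) (p q : B × S) :
    conjLeft K ρ p q = ∑ a', ∑ a, K p.1 a * ρ (a, p.2) (a', q.2) * star (K q.1 a') := by
  simp [conjLeft, conj, Matrix.mul_apply, Fintype.sum_prod_type, Matrix.one_apply,
    Finset.sum_mul, apply_ite]

theorem traceLast_add {A S E : Type} [Fintype E] (ρ σ : Op (A × S × E)) :
    traceLast (ρ + σ) = traceLast ρ + traceLast σ := by
  ext p q
  simp [traceLast, Finset.sum_add_distrib]

theorem trace_traceLast {A S E : Type} [Fintype A] [Fintype S] [Fintype E]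
    (ρ : Op (A × S × E)) : (traceLast ρ).trace = ρ.trace := by
  simp [traceLast, Matrix.trace, Fintype.sum_prod_type]

/-- The operator acts as the identity on the register traced out. This covers the adversary's gates
as well as the challenger's tests. -/
theorem traceLast_conjLeft {A B S E : Type} [Fintype A] [Fintype S] [DecidableEq S]
    [Fintype E] [DecidableEq E] (K : Matrix B A ℂ) (ρ : Op (A × S × E)) :
    traceLast (conjLeft K ρ) = conjLeft K (traceLast ρ) := by
  ext p q
  simp only [traceLast, conjLeft_apply, Matrix.of_apply, Finset.mul_sum, Finset.sum_mul]
  rw [Finset.sum_comm]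
  exact Finset.sum_congr rfl fun _ _ => Finset.sum_comm

variable {m c t w q : ℕ}

theorem traceLast_undoV {E : Type} [Fintype E] (d : EncData m c t)
    (ρ : Op (Adv m c w × (Fin q → Bits m) × E)) :
    traceLast (undoV d ρ) = undoV d (traceLast ρ) := by
  ext p q
  simp only [traceLast, undoV, conj, Matrix.mul_apply, Matrix.of_apply, Finset.mul_sum,
    Finset.sum_mul]
  rw [Finset.sum_comm]
  exact Finset.sum_congr rfl fun _ _ => Finset.sum_comm

/-- Discarding the stored plaintexts turns an encryption call of the ideal world into one of the
game with a final test. -/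
theorem traceLast_idealEnc (d : EncData m c t) (r : Bits t)
    (ρ : Op (Adv m c w × (Fin q → Bits m) × (Fin q → Bits m))) :
    traceLast (idealEnc d r ρ) = cheatEnc d r (traceLast ρ) := by
  ext ⟨⟨f, x, y, z⟩, a, _⟩ ⟨⟨f', x', y', z'⟩, a', _⟩
  simp only [traceLast, idealEnc, cheatEnc, Matrix.of_apply]
  split_ifs
  · rw [← Finset.sum_mul]
    congr 1
    -- Split off the newest stored plaintext: it is the former content of M, so summing over it is
    -- exactly discarding M.
    rw [← (Fin.snocEquiv fun _ : Fin (q + 1) => Bits m).sum_comp, Fintype.sum_prod_type]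
    have hinit : ∀ (u : Bits m) (b : Fin q → Bits m),
        Fin.init (Fin.snocEquiv (fun _ : Fin (q + 1) => Bits m) (u, b)) = b :=
      fun u b => Fin.init_snoc (α := fun _ => Bits m) u b
    simp only [hinit, Fin.snocEquiv_apply, Fin.snoc_last]
    exact Finset.sum_congr rfl fun _ _ => Finset.sum_comm
  · exact Finset.sum_const_zero

/-! ### The flag after an ideal decryption call -/

/-- The probability that the flag is `1`. -/
def flagProb {X : Type} [Fintype X] (ρ : Op (Adv m c w × X)) : ℝ :=
  ∑ s, if s.1.1 = true then (ρ s s).re else 0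

theorem flagProb_add {X : Type} [Fintype X] (ρ σ : Op (Adv m c w × X)) :
    flagProb (ρ + σ) = flagProb ρ + flagProb σ := by
  simp only [flagProb, ← Finset.sum_add_distrib]
  refine Finset.sum_congr rfl fun s _ => ?_
  split_ifs <;> simp

theorem flagProb_idealReject
    (σ : Op (Tested m t q × (Bool × Bits m × Bits w) × (Fin q → Bits m))) :
    flagProb (idealReject σ : Op (Adv m c w × (Fin q → Bits m) × (Fin q → Bits m))) = 0 := by
  refine Finset.sum_eq_zero fun s _ => ?_
  obtain ⟨⟨f, x, y, z⟩, a, b⟩ := s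
  cases f <;> simp [idealReject]

/-- A tuple amounts to its entry at `i` together with the tuple in which this entry is zeroed. This
accounts for moving a stored plaintext out and leaving zeros in its place. -/
theorem sum_update_zeros {β : Type} [AddCommMonoid β] (i : Fin q) (F : (Fin q → Bits m) → β) :
    (∑ x, ∑ b, if b i = zeros then F (Function.update b i x) else 0) = ∑ b, F b := by
  rw [← Fintype.sum_prod_type', ← Finset.sum_filter]
  refine Finset.sum_bij' (fun p _ => Function.update p.2 i p.1)
    (fun b _ => (b i, Function.update b i zeros)) ?_ ?_ ?_ ?_ ?_
  · simp
  · simp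
  · rintro ⟨x, b⟩ hb
    have hb : b i = zeros := by simpa using hb
    simp [← hb]
  · simp
  · simp

/-- An accepting answer always sets the flag, and moving the plaintext and discarding the decoded
registers preserve the trace. -/
theorem flagProb_idealAccept (i : Fin q)
    (σ : Op (Tested m t q × (Bool × Bits m × Bits w) × (Fin q → Bits m))) :
    flagProb (idealAccept i σ : Op (Adv m c w × (Fin q → Bits m) × (Fin q → Bits m))) =
      σ.trace.re := by
  set G : Bits w → (Fin q → Bits m) → (Fin q → Bits m) → ℂ := fun z a b =>
    ∑ u, ∑ g, ∑ v, σ ((u, a), (g, v, z), b) ((u, a), (g, v, z), b) with hG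
  have hdiag : ∀ x y z a b,
      (idealAccept i σ : Op (Adv m c w × (Fin q → Bits m) × (Fin q → Bits m)))
        ((true, x, y, z), a, b) ((true, x, y, z), a, b) =
      if y = zeros then if b i = zeros then G z a (Function.update b i x) else 0 else 0 := by
    intro x y z a b
    simp only [idealAccept, Matrix.of_apply, hG, true_and, and_self, ← ite_and]
  have htrace : σ.trace = ∑ z, ∑ a, ∑ b, G z a b := by
    -- Reorder the registers so that the discarded ones are summed innermost, as in `G`.
    let e : (Bits w × (Fin q → Bits m) × (Fin q → Bits m)) × (Bits m × Bits t) × Bool × Bits m ≃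
        Tested m t q × (Bool × Bits m × Bits w) × (Fin q → Bits m) :=
      { toFun := fun s => ((s.2.1, s.1.2.1), (s.2.2.1, s.2.2.2, s.1.1), s.1.2.2)
        invFun := fun s => ((s.2.1.2.2, s.1.2, s.2.2), s.1.1, s.2.1.1, s.2.1.2.1)
        left_inv := fun _ => rfl
        right_inv := fun _ => rfl }
    rw [Matrix.trace, ← e.sum_comp]
    simp only [Fintype.sum_prod_type, hG, Matrix.diag_apply, e, Equiv.coe_fn_mk]
  have hflag : flagProb (idealAccept i σ : Op (Adv m c w × (Fin q → Bits m) × (Fin q → Bits m))) =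
      (∑ x, ∑ y : Bits c, ∑ z, ∑ a, ∑ b,
        if y = zeros then if b i = zeros then G z a (Function.update b i x) else 0 else 0).re := by
    simp only [flagProb, Fintype.sum_prod_type, Fintype.sum_bool, hdiag, if_true,
      Bool.false_eq_true, if_false, Finset.sum_const_zero, add_zero, Complex.re_sum]
  rw [hflag, htrace]
  congr 1
  calc _ = ∑ x, ∑ z, ∑ a, ∑ b, if b i = zeros then G z a (Function.update b i x) else 0 :=
        Finset.sum_congr rfl fun x _ => by
          rw [Finset.sum_eq_single zeros (fun y _ hy => by simp [hy]) (by simp)]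
          simp only [if_true]
    _ = ∑ z, ∑ a, ∑ x, ∑ b, if b i = zeros then G z a (Function.update b i x) else 0 := by
        rw [Finset.sum_comm]
        exact Finset.sum_congr rfl fun _ _ => Finset.sum_comm
    _ = _ := by simp only [sum_update_zeros]

/-- After a decryption call of the ideal world, the flag is `1` with the probability that the test
passes. -/
theorem flagProb_testLoop (d : EncData m c t) (r : Fin q → Bits t) (is : List (Fin q))
    (σ : Op (Tested m t q × (Bool × Bits m × Bits w) × (Fin q → Bits m))) :
    flagProb (testLoop d r idealAccept idealReject is σ :
      Op (Adv m c w × (Fin q → Bits m) × (Fin q → Bits m))) =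
    testLoop d r (fun _ σ => σ.trace.re) (fun _ => (0 : ℝ)) is (traceLast σ) := by
  induction is generalizing σ with
  | nil => exact flagProb_idealReject σ
  | cons i is ih =>
    -- States are unnormalized, so the branches contribute additively: the accepting one gives its
    -- trace, the others are covered by the induction hypothesis.
    rw [testLoop, testLoop, flagProb_add, ih, flagProb_idealAccept, traceLast_add]
    simp only [traceLast_conjLeft, ← trace_traceLast (conjLeft (entTest i * _) σ)]

/-- The game with a final test is the ideal world with a final decryption call. -/
theorem idealRun_append_dec (d : EncData m c t) (gs : List (Gate m c w)) (hgs : Gate.dec ∉ gs)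
    (q : ℕ) (r : Fin q → Bits t) (ρ : Op (Adv m c w × (Fin q → Bits m) × (Fin q → Bits m))) :
    idealRun d (gs ++ [.dec]) q r ρ = cheatRun d gs q r (traceLast ρ) := by
  induction gs generalizing q r ρ with
  | nil =>
    change flagProb (idealDec d r ρ) = _
    rw [idealDec, flagProb_testLoop, traceLast_undoV, cheatRun]
  | cons g gs ih =>
    have ih := ih fun h => hgs (List.mem_cons_of_mem _ h)
    cases g with
    -- An earlier decryption call must be excluded: the cheating game skips it, while the ideal
    -- world would alter the state.
    | dec => exact absurd List.mem_cons_self hgs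
    | enc =>
      rw [List.cons_append, idealRun, cheatRun]
      simp only [ih, traceLast_idealEnc]
    | _ =>
      rw [List.cons_append, idealRun, cheatRun, ih, traceLast_conjLeft]

theorem traceLast_pureBasis (s : Adv m c w) :
    traceLast (SKQES.pureBasis (s, (Fin.elim0 : Fin 0 → Bits m), (Fin.elim0 : Fin 0 → Bits m))) =
      SKQES.pureBasis (s, Fin.elim0, ()) := by
  ext ⟨p, a, _⟩ ⟨p', a', _⟩
  -- Before the first encryption call the plaintext memory is one-dimensional, so tracing it out
  -- loses nothing.
  have h : ∀ b : Fin 0 → Bits m, b = Fin.elim0 := fun b => Subsingleton.elim _ _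
  simp [traceLast, SKQES.pureBasis, h]

end Ideal

/-! ## The experiments -/

namespace SKQES

variable {S : SKQES}

theorem probReal_thenDec (A : Adversary S) (n : ℕ) :
    S.probReal A.thenDec n = S.probForge A n := by
  refine congrArg (S.keyAverage n) (funext fun k => ?_)
  rw [← sum_flag_realDec]
  simp only [Adversary.thenDec, realRun_append_dec]
  rfl

theorem probIdeal_thenDec (R : S.Representation) (A : Adversary S) (hA : A.EncOnly) (n : ℕ) :
    S.probIdeal R A.thenDec n = S.probCheat R A n := by
  refine congrArg (S.keyAverage n) (funext fun k => ?_)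
  rw [← traceLast_pureBasis]
  exact idealRun_append_dec _ _ (hA n) _ _ _

end SKQES

end QCrypt

end

theorem mainTheorem4 (S : QCrypt.SKQES) (R : S.Representation) :
    (S.IsQAE R → S.IsQUF R) ∧
    ∀ (A : QCrypt.Adversary S), A.EncOnly → ∀ ν : ℕ → ℝ,
      (∀ n, S.probForge A n = S.probCheat R A n + ν n) →
      ∃ B : QCrypt.Adversary S, ∀ n,
        1 / 2 * S.probReal B n - 1 / 2 * S.probIdeal R B n = ν n / 2 := by
  refine ⟨fun h A hA => ?_, fun A hA ν hν => ⟨A.thenDec, fun n => ?_⟩⟩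
  · simpa only [QCrypt.SKQES.probReal_thenDec, QCrypt.SKQES.probIdeal_thenDec R A hA]
      using h A.thenDec
  · rw [QCrypt.SKQES.probReal_thenDec, QCrypt.SKQES.probIdeal_thenDec R A hA, hν]
    ring
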